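/- Let $(w_t)_{t\ge 0}$ be a strictly stationary and ergodic process on a probability space, with values in a measurable space $W$. Let $\Theta\subseteq\mathbb{R}^p$, and for $\theta\in\Theta$ let $f(\cdot\mid\theta)\colon W\to[0,\infty)$ be the likelihood function of one observation, where $(w,\theta)\mapsto f(w\mid\theta)$ is (jointly) measurable on $W\times\Theta$; put $\log 0=-\infty$. For every $n\ge 1$ let $\hat\theta_n$ be a maximum likelihood estimator, that is, almost surely $\hat\theta_n\in\Theta$ and $\hat\theta_n$ maximizes $\theta\mapsto\sum_{t=0}^{n-1}\log f(w_t\mid\theta)$ over $\Theta$. Suppose that, for some $\theta_0$: (i) $\theta\mapsto E[\log f(w_t\mid\theta)]$ is uniquely maximized on $\Theta$ at $\theta_0$; (ii) $\theta_0\in\Theta$, and $\Theta$ is compact; (iii) $\log f(w_t\mid\cdot)$ is continuous at each $\theta\in\Theta$ with probability one, that is, for each $\theta\in\Theta$ the function $\log f(w_t\mid\cdot)$ on $\Theta$ is almost surely continuous at $\theta$ (the exceptional null set may depend on $\theta$); (iv) $E\bigl[\sup_{\theta\in\Theta}|\log f(w_t\mid\theta)|\bigr]<\infty$. Then $\hat\theta_n\to\theta_0$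 in probability as $n\to\infty$. (By stationarity, conditions (i), (iii) and (iv) do not depend on $t$.) -/

import Mathlib

open MeasureTheory Filter
open scoped NNReal ENNReal

/-- The (one-sided) shift `(x₀, x₁, x₂, …) ↦ (x₁, x₂, x₃, …)` on the space of sequences. -/
def seqShift {W : Type*} (x : ℕ → W) : ℕ → W := fun t => x (t + 1)

/-- A process `(w t)` is ergodic stationary: every `w t` is a random variable, and the law of the
whole sequence on the path space (with the product σ-algebra) is invariant under the shift
(strict stationarity) and every shift-invariant measurable set of paths has probability
zero or one (ergodicity). Both are contained in Mathlib's `Ergodic`. -/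
structure IsErgodicStationary {Ω W : Type*} [MeasurableSpace Ω] [MeasurableSpace W]
    (μ : Measure Ω) (w : ℕ → Ω → W) : Prop where
  measurable : ∀ t, Measurable (w t)
  ergodic : Ergodic (seqShift (W := W)) (μ.map fun ω t => w t ω)

/-- The log-likelihood `log f(x | θ)` of one observation `x`, with the convention
`log 0 = -∞`. -/
noncomputable def logLik {W P : Type*} (f : W → P → ℝ≥0) (x : W) (θ : P) : EReal :=
  ENNReal.log (f x θ : ℝ≥0∞)

/-- The log-likelihood `∑ log f(x t | θ)` of the `n` observations `x 0, …, x (n - 1)`. -/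
noncomputable def sampleLogLik {W P : Type*} (f : W → P → ℝ≥0) (n : ℕ) (x : ℕ → W) (θ : P) :
    EReal :=
  ∑ t ∈ Finset.range n, logLik f (x t) θ

/-- `θ'` is a maximum likelihood estimate over `Θ` from `x 0, …, x (n - 1)`: it lies in `Θ` and
maximizes the sample log-likelihood on `Θ`. -/
def IsMLEstimate {W P : Type*} (f : W → P → ℝ≥0) (Θ : Set P) (n : ℕ) (x : ℕ → W) (θ' : P) :
    Prop :=
  θ' ∈ Θ ∧ ∀ θ ∈ Θ, sampleLogLik f n x θ ≤ sampleLogLik f n x θ'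

/-! Wald's argument. For `θ ≠ θ₀`, dominated convergence gives a ball around `θ` on which the
supremum of the log-likelihood still has expectation below the value at `θ₀`
(`exists_ball_integral_biSup_toReal_lt`). Finitely many such balls cover the points of `Θ` at
distance at least `ε` from `θ₀`. The weak law, applied to each supremum minus the log-likelihood at
`θ₀`, shows that with probability tending to one no maximizer lies in them.

Continuity holds only almost surely at each fixed point, so a supremum over a ball cannot be reduced
to a countable dense subset; its measurability up to null sets comes from the measurable projection
theorem. The weak law follows from the `L²` mean ergodic theorem by density in `L¹`. -/

/-! ### Universal measurability of analytic sets. -/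

theorem isCompact_setOf_forall_le_nat (u : ℕ → ℕ) : IsCompact {x : ℕ → ℕ | ∀ i, x i ≤ u i} := by
  have : {x : ℕ → ℕ | ∀ i, x i ≤ u i} = Set.pi Set.univ fun i => Set.Iic (u i) := by
    ext; simp only [Set.mem_ofPred_eq, Set.mem_pi, Set.mem_univ, Set.mem_Iic, true_imp_iff]
  rw [this]
  exact isCompact_univ_pi fun i => (Set.finite_Iic (u i)).isCompact

/-- Counterexamples `x k`, truncated by `u`, subconverge in the compact box. Truncation leaves the
coordinates below `k` unchanged, so the `x k` subconverge to the same point of `O`. -/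
theorem exists_forall_lt_le_subset_of_isOpen {u : ℕ → ℕ} {O : Set (ℕ → ℕ)} (hO : IsOpen O)
    (hu : {x : ℕ → ℕ | ∀ i, x i ≤ u i} ⊆ O) :
    ∃ k, {x : ℕ → ℕ | ∀ i < k, x i ≤ u i} ⊆ O := by
  by_contra! h
  simp only [Set.not_subset] at h
  choose x hx hxO using h
  obtain ⟨y, hy, s, hs, hlim⟩ := (isCompact_setOf_forall_le_nat u).tendsto_subseq
    (x := fun k i => min (x k i) (u i)) fun k i => min_le_right _ _
  have hxlim : Tendsto (x ∘ s) atTop (nhds y) := by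
    rw [tendsto_pi_nhds] at hlim ⊢
    intro i
    refine (hlim i).congr' ?_
    filter_upwards [hs.tendsto_atTop.eventually_gt_atTop i] with k hk
    exact min_eq_left (hx (s k) i hk)
  obtain ⟨k, hk⟩ := (hxlim.eventually (hO.mem_nhds (hu hy))).exists
  exact hxO _ hk

/-- An analytic set is inner regular for compact sets. -/
theorem MeasureTheory.AnalyticSet.exists_isCompact_le_measure {X : Type*} [TopologicalSpace X]
    [MeasurableSpace X] {ν : Measure X} [ν.OuterRegular] {A : Set X} (hA : AnalyticSet A)
    {r : ℝ≥0∞} (hr : r < ν A) : ∃ K ⊆ A, IsCompact K ∧ r ≤ ν K := by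
  rw [AnalyticSet] at hA
  obtain rfl | ⟨g, hg, rfl⟩ := hA
  · simp at hr
  have step : ∀ (k : ℕ) (S : {S : Set (ℕ → ℕ) // r < ν (g '' S)}),
      ∃ m, r < ν (g '' (S ∩ {x | x k ≤ m})) := by
    rintro k ⟨S, hS⟩
    have hU : g '' S = ⋃ m, g '' (S ∩ {x | x k ≤ m}) := by
      rw [← Set.image_iUnion, ← Set.inter_iUnion]
      congr 1
      ext x
      simp only [Set.mem_inter_iff, Set.mem_iUnion, Set.mem_ofPred_eq, iff_self_and]
      exact fun _ => ⟨x k, le_rfl⟩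
    have hmono : Monotone fun m => g '' (S ∩ {x | x k ≤ m}) := fun a b hab =>
      Set.image_mono (Set.inter_subset_inter_right _ fun x (hx : x k ≤ a) => hx.trans hab)
    -- Continuity from below holds for arbitrary increasing sets; these images need not be
    -- measurable.
    rw [hU, hmono.measure_iUnion] at hS
    exact lt_iSup_iff.1 hS
  choose m hm using step
  let S : ℕ → {S : Set (ℕ → ℕ) // r < ν (g '' S)} := fun k =>
    Nat.rec ⟨Set.univ, by simpa using hr⟩ (fun k S => ⟨S ∩ {x | x k ≤ m k S}, hm k S⟩) k
  let u : ℕ → ℕ := fun k => m k (S k)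
  have hS : ∀ k, (S k).1 = {x | ∀ i < k, x i ≤ u i} := by
    intro k
    induction k with
    | zero => ext; simp [S]
    | succ k ih =>
      have : (S (k + 1)).1 = (S k).1 ∩ {x | x k ≤ u k} := rfl
      rw [this, ih]
      ext x
      simp only [Set.mem_inter_iff, Set.mem_ofPred_eq, Nat.lt_succ_iff_lt_or_eq]
      exact ⟨fun h i hi => hi.elim (h.1 i) fun e => e ▸ h.2,
        fun h => ⟨fun i hi => h i (Or.inl hi), h k (Or.inr rfl)⟩⟩
  refine ⟨g '' {x | ∀ i, x i ≤ u i}, Set.image_subset_range _ _, (isCompact_setOf_forall_le_nat u).image hg, ?_⟩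
  -- By outer regularity it suffices to bound open `V` containing the compact image; such a `V`
  -- already contains the image of some `S k`.
  rw [Set.measure_eq_iInf_isOpen]
  refine le_iInf₂ fun V hV => le_iInf fun hVo => ?_
  obtain ⟨k, hk⟩ := exists_forall_lt_le_subset_of_isOpen (hVo.preimage hg) (Set.image_subset_iff.1 hV)
  rw [← hS k] at hk
  exact (S k).2.le.trans (measure_mono (Set.image_subset_iff.2 hk))

/-- Analytic sets are universally measurable. -/
theorem MeasureTheory.AnalyticSet.nullMeasurableSet {X : Type*} [TopologicalSpace X] [T2Space X]
    [MeasurableSpace X] [OpensMeasurableSpace X] {ν : Measure X} [ν.OuterRegular]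
    [IsFiniteMeasure ν] {A : Set X} (hA : AnalyticSet A) : NullMeasurableSet A ν := by
  obtain h0 | h0 := eq_or_ne (ν A) 0
  · exact .of_null h0
  obtain ⟨r, -, hr, hlim⟩ := exists_seq_strictMono_tendsto' (pos_iff_ne_zero.2 h0)
  choose K hKA hK hrK using fun n => hA.exists_isCompact_le_measure (hr n).2
  have hM : MeasurableSet (⋃ n, K n) := .iUnion fun n => (hK n).measurableSet
  have hle : ν A ≤ ν (⋃ n, K n) := le_of_tendsto' hlim fun n =>
    (hrK n).trans (measure_mono (Set.subset_iUnion K n))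
  exact hM.nullMeasurableSet.congr (ae_eq_of_subset_of_measure_ge (Set.iUnion_subset hKA) hle
    hM.nullMeasurableSet (measure_ne_top _ _))

/-! ### Measurable projection and uncountable suprema. -/

/-- A measurable subset of a product depends on its first coordinate through countably many
measurable sets only. -/
theorem MeasurableSet.exists_preimage_prodMap_natBool {W T : Type*} [MeasurableSpace W]
    [MeasurableSpace T] {S : Set (W × T)} (hS : MeasurableSet S) :
    ∃ φ : W → ℕ → Bool, Measurable φ ∧ ∃ S' : Set ((ℕ → Bool) × T), MeasurableSet S' ∧
      S = Prod.map φ id ⁻¹' S' := by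
  induction S, hS using MeasurableSpace.induction_on_inter generateFrom_prod.symm isPiSystem_prod with
  | empty => exact ⟨fun _ _ => true, measurable_const, ∅, .empty, rfl⟩
  | basic S hS =>
    obtain ⟨A, hA, B, hB, rfl⟩ := hS
    classical
    refine ⟨fun w _ => decide (w ∈ A), ?_, {q | q.1 0 = true ∧ q.2 ∈ B}, ?_, ?_⟩
    · refine measurable_pi_iff.2 fun _ => measurable_to_bool ?_
      have : (fun w => decide (w ∈ A)) ⁻¹' {true} = A := by ext; simp
      rw [this]
      exact hA
    · exact (measurableSet_eq_fun (by fun_prop) measurable_const).inter (measurable_snd hB)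
    · ext; simp
  | compl S _ ih =>
    obtain ⟨φ, hφ, S', hS', rfl⟩ := ih
    exact ⟨φ, hφ, S'ᶜ, hS'.compl, rfl⟩
  | iUnion S _ _ ih =>
    choose φ hφ S' hS' hSS' using ih
    -- The countably many codes are interleaved into one by the pairing function.
    refine ⟨fun w n => φ n.unpair.1 w n.unpair.2, ?_,
      ⋃ k, (fun q : (ℕ → Bool) × T => ((fun n => q.1 (Nat.pair k n)), q.2)) ⁻¹' S' k, ?_, ?_⟩
    · fun_prop
    · exact .iUnion fun k => (by fun_prop :
        Measurable fun q : (ℕ → Bool) × T => ((fun n => q.1 (Nat.pair k n)), q.2)) (hS' k)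
    · ext q
      simp [hSS', Prod.map]

/-- **Measurable projection theorem**: the projection of a measurable set along a standard Borel
space is universally measurable. -/
theorem MeasurableSet.nullMeasurableSet_image_fst {W T : Type*} [MeasurableSpace W]
    [MeasurableSpace T] [StandardBorelSpace T] {ν : Measure W} [IsFiniteMeasure ν]
    {S : Set (W × T)} (hS : MeasurableSet S) : NullMeasurableSet (Prod.fst '' S) ν := by
  -- `W` is arbitrary; passing to `ℕ → Bool` makes the projection analytic.
  obtain ⟨φ, hφ, S', hS', rfl⟩ := hS.exists_preimage_prodMap_natBool
  have hA : NullMeasurableSet (Prod.fst '' S') (ν.map φ) :=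
    (hS'.analyticSet_image measurable_fst).nullMeasurableSet
  have h : Prod.fst '' (Prod.map φ id ⁻¹' S') = φ ⁻¹' (Prod.fst '' S') := by
    ext w; simp
  rw [h]
  exact hA.preimage ⟨hφ, Measure.AbsolutelyContinuous.rfl⟩

/-- The supremum exceeds `c` exactly on the projection of a measurable set. -/
theorem Measurable.aemeasurable_biSup_of_standardBorel {W T R : Type*} [MeasurableSpace W]
    [MeasurableSpace T] [StandardBorelSpace T] [CompleteLinearOrder R] [TopologicalSpace R]
    [OrderTopology R] [SecondCountableTopology R] [MeasurableSpace R] [BorelSpace R]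
    {ν : Measure W} [IsFiniteMeasure ν] {g : W × T → R} (hg : Measurable g) {B : Set T}
    (hB : MeasurableSet B) : AEMeasurable (fun x => ⨆ t ∈ B, g (x, t)) ν := by
  have : NullMeasurable (fun x => ⨆ t ∈ B, g (x, t)) ν := by
    refine measurable_of_Ioi (α := R) (δ := NullMeasurableSpace W ν) fun c => ?_
    have h : (fun x => ⨆ t ∈ B, g (x, t)) ⁻¹' Set.Ioi c =
        Prod.fst '' {q : W × T | q.2 ∈ B ∧ g q ∈ Set.Ioi c} := by
      ext x
      simp [lt_iSup_iff]
    refine (congrArg (NullMeasurableSet · ν) h).mpr ?_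
    exact ((measurable_snd hB).inter (hg measurableSet_Ioi)).nullMeasurableSet_image_fst
  exact this.aemeasurable

/-! ### The mean ergodic theorem. -/

theorem MeasureTheory.Integrable.birkhoffAverage {α : Type*} [MeasurableSpace α] {P : Measure α}
    {T : α → α} (hT : MeasurePreserving T P P) {h : α → ℝ} (hh : Integrable h P) (n : ℕ) :
    Integrable (_root_.birkhoffAverage ℝ T h n) P := by
  have : _root_.birkhoffAverage ℝ T h n =
      fun x => (n : ℝ)⁻¹ • ∑ k ∈ Finset.range n, h (T^[k] x) := rfl
  rw [this]
  exact (integrable_finsetSum _ fun k _ =>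
    (hT.iterate k).integrable_comp_of_integrable hh).smul (n : ℝ)⁻¹

theorem integral_birkhoffAverage {α : Type*} [MeasurableSpace α] {P : Measure α}
    {T : α → α} (hT : MeasurePreserving T P P) {h : α → ℝ} (hh : Integrable h P) {n : ℕ}
    (hn : n ≠ 0) : ∫ x, birkhoffAverage ℝ T h n x ∂P = ∫ x, h x ∂P := by
  have hk : ∀ k, ∫ x, h (T^[k] x) ∂P = ∫ x, h x ∂P := fun k => by
    conv_rhs => rw [← (hT.iterate k).map_eq]
    rw [integral_map (hT.iterate k).aemeasurable (by
      rw [(hT.iterate k).map_eq]; exact hh.aestronglyMeasurable)]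
  have hn' : (n : ℝ) ≠ 0 := by exact_mod_cast hn
  simp only [birkhoffAverage, birkhoffSum, smul_eq_mul]
  have hi : ∀ k ∈ Finset.range n, Integrable (fun x => h (T^[k] x)) P := fun k _ =>
    (hT.iterate k).integrable_comp_of_integrable hh
  rw [integral_const_mul, integral_finsetSum _ hi]
  simp [hk, hn']

theorem eLpNorm_birkhoffAverage_le {α : Type*} [MeasurableSpace α] {P : Measure α}
    {T : α → α} (hT : MeasurePreserving T P P) {h : α → ℝ} (hh : Integrable h P) (n : ℕ) :
    eLpNorm (birkhoffAverage ℝ T h n) 1 P ≤ eLpNorm h 1 P := by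
  obtain rfl | hn := eq_or_ne n 0
  · have : birkhoffAverage ℝ T h 0 = 0 := by ext; simp
    simp [this]
  have : birkhoffAverage ℝ T h n =
      (n : ℝ)⁻¹ • ∑ k ∈ Finset.range n, h ∘ T^[k] := by
    ext x; simp [birkhoffAverage, birkhoffSum]
  have hk : ∀ k, eLpNorm (h ∘ T^[k]) 1 P = eLpNorm h 1 P := fun k =>
    eLpNorm_comp_measurePreserving hh.aestronglyMeasurable (hT.iterate k)
  have hsum : eLpNorm (∑ k ∈ Finset.range n, h ∘ T^[k]) 1 P ≤ n * eLpNorm h 1 P := by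
    refine (eLpNorm_sum_le (fun k _ =>
      hh.aestronglyMeasurable.comp_measurePreserving (hT.iterate k)) le_rfl).trans ?_
    simp [hk]
  rw [this, eLpNorm_const_smul]
  have hn' : ‖(n : ℝ)⁻¹‖ₑ = (n : ℝ≥0∞)⁻¹ := by
    rw [enorm_inv (by exact_mod_cast hn)]; simp
  rw [hn']
  calc (n : ℝ≥0∞)⁻¹ * _ ≤ (n : ℝ≥0∞)⁻¹ * (n * eLpNorm h 1 P) := by gcongr
    _ = eLpNorm h 1 P := by
      rw [← mul_assoc, ENNReal.inv_mul_cancel (by exact_mod_cast hn) (by simp), one_mul]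

/-- The mean ergodic theorem in `L²`, with convergence in the `L¹` norm. -/
theorem Ergodic.tendsto_eLpNorm_birkhoffAverage_of_memLp_two {α : Type*} [MeasurableSpace α]
    {P : Measure α} [IsProbabilityMeasure P] {T : α → α} (hT : Ergodic T P) {h : α → ℝ}
    (hh : MemLp h 2 P) :
    Tendsto (fun n => eLpNorm (fun x => birkhoffAverage ℝ T h n x - ∫ y, h y ∂P) 1 P) atTop
      (nhds 0) := by
  have hTm := hT.toMeasurePreserving
  obtain ⟨U, hU, hUcoe⟩ : ∃ U : Lp ℝ 2 P →L[ℝ] Lp ℝ 2 P, ‖U‖ ≤ 1 ∧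
      ∀ g, U g = Lp.compMeasurePreserving T hTm g :=
    ⟨LinearMap.mkContinuous (Lp.compMeasurePreservingₗ ℝ T hTm) 1 fun g => by
      rw [one_mul]; exact (Lp.norm_compMeasurePreserving g hTm).le,
      LinearMap.mkContinuous_norm_le _ zero_le_one _, fun g => rfl⟩
  have hlim := U.tendsto_birkhoffAverage_orthogonalProjection hU (hh.toLp h)
  set L : Lp ℝ 2 P := ((U.eqLocus (1 : Lp ℝ 2 P →L[ℝ] Lp ℝ 2 P)).orthogonalProjectionOnto
    (hh.toLp h) : Lp ℝ 2 P) with hL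
  have hLfix : U L = L :=
    ((U.eqLocus (1 : Lp ℝ 2 P →L[ℝ] Lp ℝ 2 P)).orthogonalProjectionOnto (hh.toLp h)).2
  -- The limit is invariant under `T`, hence constant by ergodicity.
  obtain ⟨c, hc⟩ : ∃ c, (L : α → ℝ) =ᵐ[P] Function.const α c := by
    refine hT.ae_eq_const_of_ae_eq_comp₀ (Lp.aestronglyMeasurable L).aemeasurable.nullMeasurable ?_
    refine (Lp.coeFn_compMeasurePreserving L hTm).symm.trans ?_
    rw [← hUcoe, hLfix]
  have hiter : ∀ k, ((U^[k] (hh.toLp h) : Lp ℝ 2 P) : α → ℝ) =ᵐ[P] h ∘ T^[k] := by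
    intro k
    have : (⇑U)^[k] = Lp.compMeasurePreserving T^[k] (hTm.iterate k) := by
      rw [show (⇑U) = Lp.compMeasurePreserving T hTm from funext hUcoe]
      exact Lp.compMeasurePreserving_iterate hTm k
    rw [this]
    exact (Lp.coeFn_compMeasurePreserving _ _).trans
      ((hTm.iterate k).quasiMeasurePreserving.ae_eq_comp hh.coeFn_toLp)
  have havg : ∀ n, ((_root_.birkhoffAverage ℝ U _root_.id n (hh.toLp h) : Lp ℝ 2 P) : α → ℝ) =ᵐ[P]
      birkhoffAverage ℝ T h n := by
    intro n
    have h1 : (_root_.birkhoffAverage ℝ U _root_.id n (hh.toLp h) : Lp ℝ 2 P) =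
      (n : ℝ)⁻¹ • ∑ k ∈ Finset.range n, (U^[k] (hh.toLp h) : Lp ℝ 2 P) := rfl
    rw [h1]
    filter_upwards [Lp.coeFn_smul (n : ℝ)⁻¹ (∑ k ∈ Finset.range n, (U^[k] (hh.toLp h) : Lp ℝ 2 P)),
      Lp.coeFn_fun_finsetSum (Finset.range n) (fun k => (U^[k] (hh.toLp h) : Lp ℝ 2 P)),
      ae_all_iff.2 hiter] with x h1 h2 h3
    rw [h1, Pi.smul_apply, h2]
    simp [birkhoffAverage, birkhoffSum, h3]
  have hlim2 : Tendsto (fun n => eLpNorm (fun x => birkhoffAverage ℝ T h n x - c) 2 P) atTop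
      (nhds 0) := by
    have := (Lp.tendsto_Lp_iff_tendsto_eLpNorm' _ L).1 hlim
    refine this.congr fun n => eLpNorm_congr_ae ?_
    filter_upwards [havg n, hc] with x h1 h2
    simp [h1, h2]
  have hint : Integrable h P := hh.integrable one_le_two
  have hlim1 : Tendsto (fun n => eLpNorm (fun x => birkhoffAverage ℝ T h n x - c) 1 P) atTop
      (nhds 0) := by
    refine tendsto_of_tendsto_of_tendsto_of_le_of_le tendsto_const_nhds hlim2 (fun _ => zero_le)
      fun n => eLpNorm_le_eLpNorm_of_exponent_le one_le_two ?_
    exact ((hint.birkhoffAverage hTm n).sub (integrable_const c)).aestronglyMeasurable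
  -- All averages with `n ≠ 0` have integral `∫ h`, and `L¹` convergence preserves it.
  have hcint : ∫ y, h y ∂P = c := by
    have := tendsto_integral_of_L1' (fun _ => c) aestronglyMeasurable_const
      (Eventually.of_forall fun n => hint.birkhoffAverage hTm n) hlim1
    have h2 : Tendsto (fun n => ∫ x, birkhoffAverage ℝ T h n x ∂P) atTop (nhds (∫ y, h y ∂P)) :=
      tendsto_const_nhds.congr' (by
        filter_upwards [eventually_ne_atTop 0] with n hn
        exact (integral_birkhoffAverage hTm hint hn).symm)
    simpa using tendsto_nhds_unique h2 this
  simpa [hcint] using hlim1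

/-- The mean ergodic theorem in `L¹`. -/
theorem Ergodic.tendsto_eLpNorm_birkhoffAverage {α : Type*} [MeasurableSpace α]
    {P : Measure α} [IsProbabilityMeasure P] {T : α → α} (hT : Ergodic T P) {h : α → ℝ}
    (hh : Integrable h P) :
    Tendsto (fun n => eLpNorm (fun x => birkhoffAverage ℝ T h n x - ∫ y, h y ∂P) 1 P) atTop
      (nhds 0) := by
  have hTm := hT.toMeasurePreserving
  rw [ENNReal.tendsto_nhds_zero]
  intro ε hε
  have hε3 : ε / 3 ≠ 0 := (ENNReal.div_pos hε.ne' (by simp)).ne'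
  obtain ⟨φ, hφ, -⟩ := (memLp_one_iff_integrable.2 hh).exists_simpleFunc_eLpNorm_sub_lt
    ENNReal.one_ne_top hε3
  have hφ2 : MemLp φ 2 P := φ.memLp_of_isFiniteMeasure 2 P
  have hφ1 : Integrable φ P := hφ2.integrable one_le_two
  filter_upwards [ENNReal.tendsto_nhds_zero.1
    (hT.tendsto_eLpNorm_birkhoffAverage_of_memLp_two hφ2) (ε / 3) (pos_iff_ne_zero.2 hε3)]
    with n hn
  have hsub : (fun x => birkhoffAverage ℝ T h n x - ∫ y, h y ∂P) =
      birkhoffAverage ℝ T (h - ⇑φ) n + ((fun x => birkhoffAverage ℝ T φ n x - ∫ y, φ y ∂P) +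
        fun _ => ∫ y, φ y ∂P - ∫ y, h y ∂P) := by
    ext x
    simp only [Pi.add_apply, birkhoffAverage, birkhoffSum, Pi.sub_apply, Finset.sum_sub_distrib,
      smul_eq_mul]
    ring
  have h1 := (eLpNorm_birkhoffAverage_le hTm (hh.sub hφ1) n).trans hφ.le
  have h3 : eLpNorm (fun _ : α => ∫ y, φ y ∂P - ∫ y, h y ∂P) 1 P ≤ ε / 3 := by
    rw [eLpNorm_const _ one_ne_zero (NeZero.ne P), ← integral_sub hφ1 hh]
    simp only [measure_univ, ENNReal.one_rpow, mul_one]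
    refine (enorm_integral_le_lintegral_enorm _).trans ?_
    rw [eLpNorm_sub_comm, eLpNorm_one_eq_lintegral_enorm] at hφ
    exact hφ.le
  rw [hsub]
  have m1 := (Integrable.birkhoffAverage hTm (hh.sub hφ1) n).aestronglyMeasurable
  have m2 := ((Integrable.birkhoffAverage hTm hφ1 n).sub
    (integrable_const (∫ y, φ y ∂P))).aestronglyMeasurable
  calc _ ≤ ε / 3 + (ε / 3 + ε / 3) :=
        (eLpNorm_add_le m1 (m2.add aestronglyMeasurable_const) le_rfl).trans
          (add_le_add h1 ((eLpNorm_add_le m2 aestronglyMeasurable_const le_rfl).trans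
            (add_le_add hn h3)))
    _ = ε := by rw [← add_assoc, ENNReal.add_thirds]

theorem Ergodic.tendstoInMeasure_birkhoffAverage {α : Type*} [MeasurableSpace α]
    {P : Measure α} [IsProbabilityMeasure P] {T : α → α} (hT : Ergodic T P) {h : α → ℝ}
    (hh : Integrable h P) :
    TendstoInMeasure P (birkhoffAverage ℝ T h) atTop fun _ => ∫ y, h y ∂P :=
  tendstoInMeasure_of_tendsto_eLpNorm one_ne_zero
    (fun n => (hh.birkhoffAverage hT.toMeasurePreserving n).aestronglyMeasurable)
    aestronglyMeasurable_const (hT.tendsto_eLpNorm_birkhoffAverage hh)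

/-! ### Suprema of the criterion over balls. -/

theorem EReal.mem_Icc_of_abs_le {a : EReal} {d : ℝ≥0∞} (hd : d ≠ ∞) (h : a.abs ≤ d) :
    a ∈ Set.Icc ((-d.toReal : ℝ) : EReal) (d.toReal : ℝ) := by
  induction a with
  | bot => simp [hd] at h
  | top => simp [hd] at h
  | coe x =>
    rw [EReal.abs_def, ENNReal.ofReal_le_iff_le_toReal hd, abs_le] at h
    exact ⟨EReal.coe_le_coe_iff.2 h.1, EReal.coe_le_coe_iff.2 h.2⟩

theorem EReal.coe_toReal_of_mem_Icc {a : EReal} {x y : ℝ} (h : a ∈ Set.Icc (x : EReal) y) :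
    (a.toReal : EReal) = a :=
  EReal.coe_toReal (h.2.trans_lt (EReal.coe_lt_top y)).ne ((EReal.bot_lt_coe x).trans_le h.1).ne'

theorem EReal.abs_toReal_le_of_mem_Icc {a : EReal} {x : ℝ}
    (h : a ∈ Set.Icc ((-x : ℝ) : EReal) x) : |a.toReal| ≤ x := by
  rw [← EReal.coe_toReal_of_mem_Icc h] at h
  exact abs_le.2 ⟨EReal.coe_le_coe_iff.1 h.1, EReal.coe_le_coe_iff.1 h.2⟩

theorem EReal.coe_finsetSum {ι : Type*} (s : Finset ι) (f : ι → ℝ) :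
    ((∑ i ∈ s, f i : ℝ) : EReal) = ∑ i ∈ s, (f i : EReal) := by
  classical
  induction s using Finset.induction_on with
  | empty => simp
  | insert i s hi ih => rw [Finset.sum_insert hi, Finset.sum_insert hi, EReal.coe_add, ih]

theorem ContinuousAt.tendsto_biSup_ball {T : Type*} [PseudoMetricSpace T] {g : T → EReal} {t : T}
    (hg : ContinuousAt g t) :
    Tendsto (fun k : ℕ => ⨆ s ∈ Metric.ball t (1 / (k + 1 : ℝ)), g s) atTop (nhds (g t)) := by
  refine tendsto_order.2 ⟨fun a ha => Eventually.of_forall fun k => ?_, fun b hb => ?_⟩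
  · exact ha.trans_le (le_iSup₂_of_le t (Metric.mem_ball_self (by positivity)) le_rfl)
  · obtain ⟨c, hc, hcb⟩ := exists_between hb
    obtain ⟨δ, hδ, hball⟩ := Metric.mem_nhds_iff.1 (hg.eventually_lt_const hc)
    filter_upwards [tendsto_one_div_add_atTop_nhds_zero_nat.eventually_lt_const hδ] with k hk
    exact (iSup₂_le fun s hs => (hball (Metric.ball_subset_ball hk.le hs)).le).trans_lt hcb

theorem biSup_mem_Icc_of_iSup_abs_ne_top {T : Type*} {g : T → EReal} (h : ⨆ t, (g t).abs ≠ ∞) {B : Set T}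
    (hB : B.Nonempty) : ⨆ s ∈ B, g s ∈
      Set.Icc ((-(⨆ t, (g t).abs).toReal : ℝ) : EReal) ((⨆ t, (g t).abs).toReal : ℝ) := by
  have hs := fun s => EReal.mem_Icc_of_abs_le h (le_iSup (fun t => (g t).abs) s)
  obtain ⟨s, hsB⟩ := hB
  exact ⟨(hs s).1.trans (le_iSup₂_of_le s hsB le_rfl), iSup₂_le fun s _ => (hs s).2⟩

section Envelope

variable {Ω W T : Type*} [MeasurableSpace Ω] [MeasurableSpace W] {μ : Measure Ω}
  [IsProbabilityMeasure μ] [MetricSpace T] [CompactSpace T] [MeasurableSpace T] [BorelSpace T]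
  {ℓ : W → T → EReal}

theorem aemeasurable_biSup_toReal {ν : Measure W} [IsFiniteMeasure ν]
    (hℓ : Measurable (Function.uncurry ℓ)) {B : Set T} (hB : MeasurableSet B) :
    AEMeasurable (fun x => (⨆ s ∈ B, ℓ x s).toReal) ν :=
  measurable_ereal_toReal.comp_aemeasurable (hℓ.aemeasurable_biSup_of_standardBorel hB)

theorem aemeasurable_iSup_abs {ν : Measure W} [IsFiniteMeasure ν]
    (hℓ : Measurable (Function.uncurry ℓ)) : AEMeasurable (fun x => ⨆ s, (ℓ x s).abs) ν := by
  have habs : Measurable EReal.abs := EReal.measurable_of_measurable_real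
    (ENNReal.measurable_ofReal.comp measurable_abs)
  simpa using (habs.comp hℓ).aemeasurable_biSup_of_standardBorel (ν := ν) MeasurableSet.univ

theorem ae_iSup_abs_ne_top {ν : Measure W} [IsFiniteMeasure ν]
    (hℓ : Measurable (Function.uncurry ℓ)) (hdom : ∫⁻ x, ⨆ s, (ℓ x s).abs ∂ν ≠ ∞) :
    ∀ᵐ x ∂ν, ⨆ s, (ℓ x s).abs ≠ ∞ :=
  (ae_lt_top' (aemeasurable_iSup_abs hℓ) hdom).mono fun _ h => h.ne

theorem integrable_biSup_toReal {ν : Measure W} [IsFiniteMeasure ν]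
    (hℓ : Measurable (Function.uncurry ℓ)) (hdom : ∫⁻ x, ⨆ s, (ℓ x s).abs ∂ν ≠ ∞) {B : Set T}
    (hB : MeasurableSet B) (hBne : B.Nonempty) :
    Integrable (fun x => (⨆ s ∈ B, ℓ x s).toReal) ν := by
  refine (integrable_toReal_of_lintegral_ne_top (aemeasurable_iSup_abs hℓ) hdom).mono'
    (aemeasurable_biSup_toReal hℓ hB).aestronglyMeasurable ?_
  filter_upwards [ae_iSup_abs_ne_top hℓ hdom] with x hx
  exact EReal.abs_toReal_le_of_mem_Icc (biSup_mem_Icc_of_iSup_abs_ne_top hx hBne)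

/-- As the radius shrinks, the suprema tend almost surely to the value at `t`, dominated by the
integrable envelope. -/
theorem exists_ball_integral_biSup_toReal_lt (hℓ : Measurable (Function.uncurry ℓ)) {X : Ω → W}
    (hX : Measurable X) (hdom : ∫⁻ x, ⨆ s, (ℓ x s).abs ∂(μ.map X) ≠ ∞) {t : T}
    (hcont : ∀ᵐ ω ∂μ, ContinuousAt (ℓ (X ω)) t) {c : ℝ} (hc : ∫ ω, (ℓ (X ω) t).toReal ∂μ < c) :
    ∃ r > 0, ∫ ω, (⨆ s ∈ Metric.ball t r, ℓ (X ω) s).toReal ∂μ < c := by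
  have : IsFiniteMeasure (μ.map X) := Measure.isFiniteMeasure_map μ X
  have hfin := ae_of_ae_map hX.aemeasurable (ae_iSup_abs_ne_top hℓ hdom)
  have hD := (integrable_toReal_of_lintegral_ne_top (aemeasurable_iSup_abs hℓ) hdom).comp_measurable
    hX
  have hlim : Tendsto
      (fun k : ℕ => ∫ ω, (⨆ s ∈ Metric.ball t (1 / (k + 1 : ℝ)), ℓ (X ω) s).toReal ∂μ) atTop
      (nhds (∫ ω, (ℓ (X ω) t).toReal ∂μ)) := by
    refine tendsto_integral_of_dominated_convergence _ (fun k =>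
      ((aemeasurable_biSup_toReal hℓ Metric.isOpen_ball.measurableSet).comp_measurable
        hX).aestronglyMeasurable) hD (fun k => ?_) ?_
    · filter_upwards [hfin] with ω hω
      exact EReal.abs_toReal_le_of_mem_Icc
        (biSup_mem_Icc_of_iSup_abs_ne_top hω ⟨t, Metric.mem_ball_self (by positivity)⟩)
    · filter_upwards [hfin, hcont] with ω hω hωt
      have h := EReal.mem_Icc_of_abs_le hω (le_iSup (fun t => (ℓ (X ω) t).abs) t)
      exact (EReal.tendsto_toReal (h.2.trans_lt (EReal.coe_lt_top _)).ne
        ((EReal.bot_lt_coe _).trans_le h.1).ne').comp hωt.tendsto_biSup_ball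
  obtain ⟨k, hk⟩ := (hlim.eventually_lt_const hc).exists
  exact ⟨1 / (k + 1), by positivity, hk⟩

end Envelope

/-! ### The weak law for the process. -/

theorem seqShift_iterate_apply {W : Type*} (n t : ℕ) (x : ℕ → W) :
    seqShift^[n] x t = x (t + n) := by
  induction n generalizing x with
  | zero => rfl
  | succ n ih => rw [Function.iterate_succ_apply, ih]; exact congrArg x (by ring)

namespace IsErgodicStationary

variable {Ω W : Type*} [MeasurableSpace Ω] [MeasurableSpace W] {μ : Measure Ω}
  {w : ℕ → Ω → W}

theorem measurable_path (hw : IsErgodicStationary μ w) : Measurable fun ω t => w t ω :=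
  measurable_pi_iff.2 hw.measurable

theorem map_eq_map_zero (hw : IsErgodicStationary μ w) (t : ℕ) : μ.map (w t) = μ.map (w 0) := by
  have hcoord : ∀ s, (μ.map fun ω t => w t ω).map (fun x => x s) = μ.map (w s) := fun s =>
    Measure.map_map (measurable_pi_apply s) hw.measurable_path
  have hshift := hw.ergodic.toMeasurePreserving.iterate t
  rw [← hcoord t, ← hcoord 0, ← congrArg (Measure.map fun x => x 0) hshift.map_eq,
    Measure.map_map (measurable_pi_apply 0) hshift.measurable]
  congr 1
  ext x
  simp [seqShift_iterate_apply]

/-- The weak law of large numbers for ergodic stationary processes. -/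
theorem tendsto_measure_sum_nonneg [IsProbabilityMeasure μ] (hw : IsErgodicStationary μ w)
    {h : W → ℝ} (hh : Integrable h (μ.map (w 0))) (hneg : ∫ ω, h (w 0 ω) ∂μ < 0) :
    Tendsto (fun n : ℕ => μ {ω | 0 ≤ (n : ℝ)⁻¹ * ∑ t ∈ Finset.range n, h (w t ω)}) atTop (nhds 0) := by
  set P := μ.map fun ω t => w t ω with hP
  have : IsProbabilityMeasure P := Measure.isProbabilityMeasure_map hw.measurable_path.aemeasurable
  have hcoord : P.map (fun x => x 0) = μ.map (w 0) :=
    Measure.map_map (measurable_pi_apply 0) hw.measurable_path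
  rw [← hcoord] at hh
  have hint : Integrable (fun x : ℕ → W => h (x 0)) P := hh.comp_measurable (measurable_pi_apply 0)
  have hval : ∫ x : ℕ → W, h (x 0) ∂P = ∫ ω, h (w 0 ω) ∂μ :=
    integral_map hw.measurable_path.aemeasurable hint.aestronglyMeasurable
  have hlim := hw.ergodic.tendstoInMeasure_birkhoffAverage hint
  rw [← hP, hval] at hlim
  -- A nonnegative average deviates from the negative mean by at least this threshold.
  have hlim' := (tendstoInMeasure_iff_norm.1 hlim) (-∫ ω, h (w 0 ω) ∂μ) (neg_pos.2 hneg)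
  refine tendsto_of_tendsto_of_tendsto_of_le_of_le tendsto_const_nhds hlim' (fun _ => zero_le)
    fun n => ?_
  refine le_trans (measure_mono ?_) (Measure.le_map_apply hw.measurable_path.aemeasurable _)
  intro ω hω
  simp only [Set.mem_preimage, Set.mem_ofPred_eq, birkhoffAverage, birkhoffSum,
    seqShift_iterate_apply, zero_add, smul_eq_mul] at hω ⊢
  exact le_trans (by linarith) (le_abs_self _)

end IsErgodicStationary

/-! ### Consistency. -/

/-- **Wald's consistency argument**: with probability tending to one, the sample average of a
dominated, pointwise almost surely continuous criterion on a compact space is larger at the unique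
maximizer `t₀` of its expectation than at all points at distance at least `ε` from `t₀`. -/
theorem tendsto_measure_exists_sum_le {Ω W T : Type*} [MeasurableSpace Ω] [MeasurableSpace W]
    {μ : Measure Ω} [IsProbabilityMeasure μ] [MetricSpace T] [CompactSpace T] [MeasurableSpace T]
    [BorelSpace T] {ℓ : W → T → EReal} {w : ℕ → Ω → W} (hw : IsErgodicStationary μ w)
    (hℓ : Measurable (Function.uncurry ℓ)) (hdom : ∫⁻ ω, ⨆ s, (ℓ (w 0 ω) s).abs ∂μ ≠ ∞)
    (hcont : ∀ t, ∀ᵐ ω ∂μ, ContinuousAt (ℓ (w 0 ω)) t) {t₀ : T}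
    (hmax : ∀ t, t ≠ t₀ → ∫ ω, (ℓ (w 0 ω) t).toReal ∂μ < ∫ ω, (ℓ (w 0 ω) t₀).toReal ∂μ)
    {ε : ℝ} (hε : 0 < ε) :
    Tendsto (fun n => μ {ω | ∃ t, ε ≤ dist t t₀ ∧
      ∑ i ∈ Finset.range n, ℓ (w i ω) t₀ ≤ ∑ i ∈ Finset.range n, ℓ (w i ω) t}) atTop (nhds 0) := by
  have hX := hw.measurable 0
  set ν := μ.map (w 0) with hν
  have : IsProbabilityMeasure ν := Measure.isProbabilityMeasure_map hX.aemeasurable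
  have hdomν : ∫⁻ x, ⨆ s, (ℓ x s).abs ∂ν ≠ ∞ := by
    rwa [lintegral_map' (aemeasurable_iSup_abs hℓ) hX.aemeasurable]
  have hball : ∀ t, ∃ r > 0, t ≠ t₀ →
      ∫ ω, (⨆ s ∈ Metric.ball t r, ℓ (w 0 ω) s).toReal ∂μ < ∫ ω, (ℓ (w 0 ω) t₀).toReal ∂μ := by
    intro t
    by_cases ht : t = t₀
    -- A dummy radius: the centres in `F` avoid `t₀`.
    · exact ⟨1, one_pos, fun h => absurd ht h⟩
    · obtain ⟨r, hr, h⟩ := exists_ball_integral_biSup_toReal_lt hℓ hX hdomν (hcont t) (hmax t ht)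
      exact ⟨r, hr, fun _ => h⟩
  choose r hr hrlt using hball
  have hK : IsCompact {t : T | ε ≤ dist t t₀} :=
    (isClosed_le continuous_const (continuous_id.dist continuous_const)).isCompact
  obtain ⟨F, hFK, hcov⟩ := hK.elim_nhds_subcover (fun t => Metric.ball t (r t))
    fun t _ => Metric.ball_mem_nhds t (hr t)
  let h : T → W → ℝ := fun t x => (⨆ s ∈ Metric.ball t (r t), ℓ x s).toReal - (ℓ x t₀).toReal
  have hint₁ : ∀ t, Integrable (fun x => (⨆ s ∈ Metric.ball t (r t), ℓ x s).toReal) ν := fun t =>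
    integrable_biSup_toReal hℓ hdomν Metric.isOpen_ball.measurableSet
      ⟨t, Metric.mem_ball_self (hr t)⟩
  have hint₂ : Integrable (fun x => (ℓ x t₀).toReal) ν := by
    simpa using integrable_biSup_toReal hℓ hdomν (measurableSet_singleton t₀)
      (Set.singleton_nonempty t₀)
  have hlim : ∀ t ∈ F, Tendsto (fun n : ℕ =>
      μ {ω | 0 ≤ (n : ℝ)⁻¹ * ∑ i ∈ Finset.range n, h t (w i ω)}) atTop (nhds 0) := by
    intro t ht
    refine hw.tendsto_measure_sum_nonneg ((hint₁ t).sub hint₂) ?_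
    have htne : t ≠ t₀ := by
      rintro rfl
      have := hFK t ht
      simp only [Set.mem_ofPred_eq, dist_self] at this
      linarith
    have := integral_sub ((hint₁ t).comp_measurable hX) (hint₂.comp_measurable hX)
    simp only [Function.comp_apply] at this
    simp only [h, this]
    linarith [hrlt t htne]
  have hsum : Tendsto (fun n : ℕ => ∑ t ∈ F,
      μ {ω | 0 ≤ (n : ℝ)⁻¹ * ∑ i ∈ Finset.range n, h t (w i ω)}) atTop (nhds 0) := by
    simpa using tendsto_finsetSum F hlim
  -- Stationarity carries finiteness to all times, so `toReal` loses nothing in the sums below.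
  have hfin : ∀ᵐ ω ∂μ, ∀ i, ⨆ s, (ℓ (w i ω) s).abs ≠ ∞ := ae_all_iff.2 fun i => by
    have h := ae_iSup_abs_ne_top hℓ hdomν
    rw [hν, ← hw.map_eq_map_zero i] at h
    exact ae_of_ae_map (hw.measurable i).aemeasurable h
  refine tendsto_of_tendsto_of_tendsto_of_le_of_le tendsto_const_nhds hsum (fun _ => zero_le)
    fun n => ?_
  refine le_trans (measure_mono_ae ?_) (measure_biUnion_finset_le F _)
  filter_upwards [hfin] with ω hω
  rintro ⟨t, ht, hle⟩
  obtain ⟨u, hu, htu⟩ := Set.mem_iUnion₂.1 (hcov ht)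
  refine Set.mem_iUnion₂.2 ⟨u, hu, ?_⟩
  have hU : ∀ i, ((⨆ s ∈ Metric.ball u (r u), ℓ (w i ω) s).toReal : EReal) =
      ⨆ s ∈ Metric.ball u (r u), ℓ (w i ω) s := fun i =>
    EReal.coe_toReal_of_mem_Icc (biSup_mem_Icc_of_iSup_abs_ne_top (hω i) ⟨t, htu⟩)
  have h₀ : ∀ i, ((ℓ (w i ω) t₀).toReal : EReal) = ℓ (w i ω) t₀ := fun i =>
    EReal.coe_toReal_of_mem_Icc (EReal.mem_Icc_of_abs_le (hω i)
      (le_iSup (fun t => (ℓ (w i ω) t).abs) t₀))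
  have hle' : ((∑ i ∈ Finset.range n, (ℓ (w i ω) t₀).toReal : ℝ) : EReal) ≤
      (∑ i ∈ Finset.range n, (⨆ s ∈ Metric.ball u (r u), ℓ (w i ω) s).toReal : ℝ) := by
    simp only [EReal.coe_finsetSum, h₀, hU]
    exact hle.trans (Finset.sum_le_sum fun i _ => le_iSup₂_of_le t htu le_rfl)
  rw [EReal.coe_le_coe_iff] at hle'
  simp only [Set.mem_ofPred_eq, h, Finset.sum_sub_distrib]
  exact mul_nonneg (by positivity) (sub_nonneg.2 hle')

theorem proposition2 {Ω W : Type*} [MeasurableSpace Ω] [MeasurableSpace W] (p : ℕ)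
    (μ : Measure Ω) [IsProbabilityMeasure μ]
    (w : ℕ → Ω → W) (hw : IsErgodicStationary μ w)
    (Θ : Set (EuclideanSpace ℝ (Fin p))) (θ₀ : EuclideanSpace ℝ (Fin p))
    (f : W → EuclideanSpace ℝ (Fin p) → ℝ≥0)
    (hf : Measurable fun q : W × Θ => f q.1 q.2)
    -- the maximum likelihood estimator; no measurability of it is needed
    (θhat : ℕ → Ω → EuclideanSpace ℝ (Fin p))
    (hθhat : ∀ n, 1 ≤ n → ∀ᵐ ω ∂μ, IsMLEstimate f Θ n (fun t => w t ω) (θhat n ω))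
    -- (i): by (iv), the log-likelihoods are finite almost surely and integrable
    (h_max : ∀ θ ∈ Θ, θ ≠ θ₀ →
      ∫ ω, (logLik f (w 0 ω) θ).toReal ∂μ < ∫ ω, (logLik f (w 0 ω) θ₀).toReal ∂μ)
    -- (ii)
    (h_mem : θ₀ ∈ Θ) (h_compact : IsCompact Θ)
    -- (iii)
    (h_cont : ∀ θ ∈ Θ, ∀ᵐ ω ∂μ, ContinuousWithinAt (logLik f (w 0 ω)) Θ θ)
    -- (iv)
    (h_dom : ∫⁻ ω, ⨆ θ ∈ Θ, (logLik f (w 0 ω) θ).abs ∂μ < ∞) :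
    TendstoInMeasure μ θhat atTop (fun _ => θ₀) := by
  have : CompactSpace Θ := isCompact_iff_compactSpace.1 h_compact
  have hℓ : Measurable (Function.uncurry fun (x : W) (θ : Θ) => logLik f x θ) :=
    ENNReal.measurable_log.comp hf.coe_nnreal_ennreal
  rw [tendstoInMeasure_iff_dist]
  intro ε hε
  have hlim := tendsto_measure_exists_sum_le (t₀ := (⟨θ₀, h_mem⟩ : Θ)) hw hℓ
    (by simpa only [iSup_subtype'] using h_dom.ne)
    (fun θ => (h_cont θ θ.2).mono fun ω hω =>
      (continuousWithinAt_iff_continuousAt_domRestrict _ θ.2).1 hω)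
    (fun θ hθ => h_max θ θ.2 fun h => hθ (Subtype.ext h)) hε
  refine tendsto_of_tendsto_of_tendsto_of_le_of_le' tendsto_const_nhds hlim
    (Eventually.of_forall fun _ => zero_le) ?_
  filter_upwards [eventually_ge_atTop 1] with n hn
  -- Monotonicity holds for the outer measure, so the events may be nonmeasurable.
  refine measure_mono_ae ?_
  filter_upwards [hθhat n hn] with ω hω hdist
  exact ⟨⟨θhat n ω, hω.1⟩, hdist, hω.2 θ₀ h_mem⟩
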